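/- **Setting.** Let $N\ge 1$ and let $\Omega\subset\mathbb R^N$ be a bounded open set with Lipschitz boundary. Let $f\in L^1(\Omega)$ be nonnegative. Let $h:[0,\infty)\to(0,\infty]$ be continuous and finite outside the origin, such that there are $c,s_1>0$ and $\gamma\ge 0$ with $h(s)\le c/s^{\gamma}$ for $s\le s_1$ (with $c/0^\gamma=\infty$ if $\gamma>0$ and $c/0^0=c$), and such that the limit $h(\infty):=\lim_{s\to\infty}h(s)$ exists and is finite. For $k>0$ let $T_k(s)=\max(-k,\min(s,k))$. Products use $\infty\cdot 0=0$. Let $\mathcal{DM}^\infty(\Omega)$ be the space of the fields $z\in L^\infty(\Omega)^N$ whose distributional divergence is a measure of finite total variation on $\Omega$. For such $z$, $[z,\nu]\in L^\infty(\partial\Omega)$ denotes the weak trace of the outward normal component, characterized by $$\int_\Omega w\,\operatorname{div}z+\int_\Omega z\cdot\nabla w\,dx=\int_{\partial\Omega}[z,\nu]\,w\,d\mathcal H^{N-1}\qquad\text{for all } w\in C^1_c(\mathbb R^N).$$ For $v\in BV_{\rm loc}(\Omega)\cap L^\infty(\Omega)$ with precise representative $v^*$, $(z,Dv)$ denotes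 the distribution $$\langle (z,Dv),\varphi\rangle=-\int_\Omega v^*\varphi\,\operatorname{div}z-\int_\Omega v\,z\cdot\nabla\varphi\,dx,\qquad\varphi\in C_c^1(\Omega).$$ A function $u:\Omega\to[0,\infty]$ with $T_k(u)\in BV_{\rm loc}(\Omega)$ for all $k>0$ is called a *solution* of $$-\Delta_1u=h(u)f\ \text{ in }\Omega,\qquad u\ge 0\ \text{ in }\Omega,\qquad u=0\ \text{ on }\partial\Omega$$ if $h(u)f\in L^1(\Omega)$ and there is $z\in\mathcal{DM}^\infty(\Omega)$ with $\|z\|_{L^\infty(\Omega)^N}\le 1$ such that 1. $-\operatorname{div}z=h(u)f$ as measures in $\Omega$; 2. $(z,DT_k(u))=|DT_k(u)|$ as measures in $\Omega$ for every $k>0$; 3. for $\mathcal H^{N-1}$-a.e. $x\in\partial\Omega$, either $\displaystyle\lim_{\epsilon\to0^+}\frac{1}{|\Omega\cap B(x,\epsilon)|}\int_{\Omega\cap B(x,\epsilon)}T_k(u(y))\,dy=0$ for every $k>0$, or $[z,\nu](x)=-1$. Let $W_0^{1,1}(\Omega)$ be the closure of $C_c^1(\Omega)$ in $W^{1,1}(\Omega)$,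 with the norm $\|v\|=\int_\Omega|\nabla v|\,dx$, and let $W^{-1,\infty}(\Omega)$ be its dual space with the dual norm. **Proposition.** If $u$ is a solution, then $h(u)f\in W^{-1,\infty}(\Omega)$ and $\|h(u)f\|_{W^{-1,\infty}(\Omega)}\le 1$. That is, for every $v\in W_0^{1,1}(\Omega)$ the function $h(u)f\,v$ is integrable on $\Omega$, and $v\mapsto\int_\Omega h(u)f\,v\,dx$ is a continuous linear functional on $W_0^{1,1}(\Omega)$ of norm at most $1$. -/

import Mathlib

open MeasureTheory Set Filter Topology Metric
open scoped ENNReal NNReal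

namespace OneLaplace

/-- The Euclidean space `ℝ^N`. -/
abbrev Eucl (N : ℕ) : Type := EuclideanSpace ℝ (Fin N)

variable {N : ℕ}

/-! ### Domains and test functions -/

/-- `Ω` has a Lipschitz boundary: near each boundary point, after choosing a unit direction `e`,
`Ω` is the set of points lying strictly above (in direction `e`) the graph of a Lipschitz function
of the component orthogonal to `e`. -/
def HasLipschitzBoundary (Ω : Set (Eucl N)) : Prop :=
  ∀ x₀ ∈ frontier Ω, ∃ (e : Eucl N) (γ : Eucl N → ℝ) (K : ℝ≥0) (r : ℝ),
    ‖e‖ = 1 ∧ LipschitzWith K γ ∧ 0 < r ∧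
    ∀ x ∈ ball x₀ r, x ∈ Ω ↔ γ (x - inner ℝ x e • e) < inner ℝ x e

/-- `φ ∈ C_c^1(ω)`, as a function on the whole space vanishing outside a compact subset of `ω`. -/
structure IsTest (ω : Set (Eucl N)) (φ : Eucl N → ℝ) : Prop where
  contDiff : ContDiff ℝ 1 φ
  hasCompactSupport : HasCompactSupport φ
  tsupport_subset : tsupport φ ⊆ ω

/-! ### Functions of bounded variation -/

/-- The vector-valued measure `D` is the distributional gradient of `v` in the open set `ω`. -/
def IsGradientMeasure (ω : Set (Eucl N)) (v : Eucl N → ℝ) (D : VectorMeasure (Eucl N) (Eucl N)) :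
    Prop :=
  ∀ φ, IsTest ω φ → ∫ x in ω, v x • gradient φ x = -∫ᵛ x, φ x ∂•D

/-- `v ∈ BV(ω)`. A vector measure with values in a finite-dimensional space automatically has
finite total variation. -/
def MemBV (ω : Set (Eucl N)) (v : Eucl N → ℝ) : Prop :=
  IntegrableOn v ω ∧ ∃ D, IsGradientMeasure ω v D

/-- `ω` is open and `ω ⊂⊂ Ω`. -/
def CompactlyInside (ω Ω : Set (Eucl N)) : Prop :=
  IsOpen ω ∧ IsCompact (closure ω) ∧ closure ω ⊆ Ω

/-- `v ∈ BV_loc(Ω)`. -/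
def MemBVLoc (Ω : Set (Eucl N)) (v : Eucl N → ℝ) : Prop :=
  ∀ ω, CompactlyInside ω Ω → MemBV ω v

/-- `a` is the approximate limit of `v` at `x`. -/
def IsApproxLimit (v : Eucl N → ℝ) (x : Eucl N) (a : ℝ) : Prop :=
  Tendsto (fun r : ℝ => ⨍ y in ball x r, |v y - a|) (𝓝[>] 0) (𝓝 0)

/-- `v` has at `x` an approximate jump with direction `n` and one-sided limits `a` and `b`. -/
def IsApproxJump (v : Eucl N → ℝ) (x : Eucl N) (a b : ℝ) (n : Eucl N) : Prop :=
  a ≠ b ∧ ‖n‖ = 1 ∧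
  Tendsto (fun r : ℝ => ⨍ y in ball x r ∩ {y | 0 < inner ℝ (y - x) n}, |v y - a|)
    (𝓝[>] 0) (𝓝 0) ∧
  Tendsto (fun r : ℝ => ⨍ y in ball x r ∩ {y | inner ℝ (y - x) n < 0}, |v y - b|)
    (𝓝[>] 0) (𝓝 0)

open Classical in
/-- The precise representative `v^*`: the approximate limit where it exists, the half-sum of the
one-sided limits at jump points, and `0` at the remaining points (for a function of bounded
variation these are negligible for the `(N-1)`-dimensional Hausdorff measure). -/
noncomputable def preciseRep (v : Eucl N → ℝ) (x : Eucl N) : ℝ :=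
  if h : ∃ a, IsApproxLimit v x a then h.choose
  else if h' : ∃ p : ℝ × ℝ, ∃ n, IsApproxJump v x p.1 p.2 n then
    (h'.choose.1 + h'.choose.2) / 2
  else 0

/-! ### Bounded vector fields whose divergence is a measure -/

/-- The signed (hence finite) measure `μ` is the distributional divergence of `z` in `Ω`.
Only the values of `μ` on subsets of `Ω` matter. -/
def IsDivergence (Ω : Set (Eucl N)) (z : Eucl N → Eucl N) (μ : SignedMeasure (Eucl N)) : Prop :=
  ∀ φ, IsTest Ω φ → ∫ x in Ω, inner ℝ (z x) (gradient φ x) = -∫ᵛ x in Ω, φ x ∂•μ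

/-- `z` is an essentially bounded vector field on `Ω` with `div z = μ`, a finite measure. -/
def MemDM (Ω : Set (Eucl N)) (z : Eucl N → Eucl N) (μ : SignedMeasure (Eucl N)) : Prop :=
  MemLp z ∞ (volume.restrict Ω) ∧ IsDivergence Ω z μ

/-- The distribution `(z, Dv)` applied to `φ`, where `μ = div z`:
`⟨(z, Dv), φ⟩ = -∫_Ω v^* φ div z - ∫_Ω v z · ∇φ dx`. -/
noncomputable def pairing (Ω : Set (Eucl N)) (z : Eucl N → Eucl N) (μ : SignedMeasure (Eucl N))
    (v φ : Eucl N → ℝ) : ℝ :=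
  -(∫ᵛ x in Ω, preciseRep v x * φ x ∂•μ) - ∫ x in Ω, v x * inner ℝ (z x) (gradient φ x)

/-- `(z, Dv) = |Dv|` as measures in `Ω`, where `μ = div z`. Here `|Dv|` is the total variation of
the gradient measure, and the equality is tested locally since `v` is only in `BV_loc(Ω)`. -/
def PairingEqVariation (Ω : Set (Eucl N)) (z : Eucl N → Eucl N) (μ : SignedMeasure (Eucl N))
    (v : Eucl N → ℝ) : Prop :=
  ∀ ω, CompactlyInside ω Ω → ∃ D, IsGradientMeasure ω v D ∧
    ∀ φ, IsTest ω φ → pairing Ω z μ v φ = ∫ x, φ x ∂D.variation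

/-- The surface measure on `∂Ω`: the `(N-1)`-dimensional Hausdorff measure, normalised to agree
with the Lebesgue measure in dimension `N-1`. -/
noncomputable def surfaceMeasure (Ω : Set (Eucl N)) : Measure (Eucl N) :=
  (Measure.euclideanHausdorffMeasure (N - 1) : Measure (Eucl N)).restrict (frontier Ω)

/-- `g` is the weak trace `[z, ν]` on `∂Ω` of the normal component of `z` (with respect to the
outward normal `ν`), where `μ = div z`: it is the bounded function on `∂Ω` for which the
Gauss-Green formula holds. -/
def IsNormalTrace (Ω : Set (Eucl N)) (z : Eucl N → Eucl N) (μ : SignedMeasure (Eucl N))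
    (g : Eucl N → ℝ) : Prop :=
  MemLp g ∞ (surfaceMeasure Ω) ∧
  ∀ w : Eucl N → ℝ, ContDiff ℝ 1 w → HasCompactSupport w →
    (∫ᵛ x in Ω, w x ∂•μ) + ∫ x in Ω, inner ℝ (z x) (gradient w x) =
      ∫ x, g x * w x ∂(surfaceMeasure Ω)

/-! ### Solutions of the Dirichlet problem -/

/-- The truncation `T_k(s) = max (-k, min (s, k))` for `k > 0` and `s ∈ [0, ∞]`, where it is
`min (s, k)`. -/
noncomputable def trunc (k : ℝ) (s : ℝ≥0∞) : ℝ := (min s (ENNReal.ofReal k)).toReal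

/-- The extension of `h : [0, ∞) → (0, ∞]` to `[0, ∞]` by its limit `hinf` at infinity. -/
noncomputable def extendAtInfty (h : ℝ≥0 → ℝ≥0∞) (hinf : ℝ≥0) (s : ℝ≥0∞) : ℝ≥0∞ :=
  if s = ∞ then (hinf : ℝ≥0∞) else h s.toNNReal

/-- The function `h(u) f`, with values in `[0, ∞]`, for a nonnegative datum `f`. -/
noncomputable def reaction (h : ℝ≥0 → ℝ≥0∞) (hinf : ℝ≥0) (f : Eucl N → ℝ) (u : Eucl N → ℝ≥0∞)
    (x : Eucl N) : ℝ≥0∞ :=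
  extendAtInfty h hinf (u x) * ENNReal.ofReal (f x)

/-- `u : Ω → [0, ∞]` is a solution of `-Δ₁ u = h(u) f` in `Ω`, `u ≥ 0` in `Ω`, `u = 0` on `∂Ω`. -/
def IsSolution (Ω : Set (Eucl N)) (h : ℝ≥0 → ℝ≥0∞) (hinf : ℝ≥0) (f : Eucl N → ℝ)
    (u : Eucl N → ℝ≥0∞) : Prop :=
  (∀ k : ℝ, 0 < k → MemBVLoc Ω (fun x => trunc k (u x))) ∧
  ∃ (z : Eucl N → Eucl N) (μ : SignedMeasure (Eucl N)),
    MemDM Ω z μ ∧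
    eLpNorm z ∞ (volume.restrict Ω) ≤ 1 ∧
    Integrable (reaction h hinf f u) (volume.restrict Ω) ∧
    -- `-div z = h(u) f` as measures in `Ω`
    (∀ B, MeasurableSet B → B ⊆ Ω → -(μ B) = ∫ x in B, (reaction h hinf f u x).toReal) ∧
    (∀ k : ℝ, 0 < k → PairingEqVariation Ω z μ (fun x => trunc k (u x))) ∧
    -- the boundary condition
    ∃ g : Eucl N → ℝ, IsNormalTrace Ω z μ g ∧
      ∀ᵐ x ∂(surfaceMeasure Ω),
        (∀ k : ℝ, 0 < k →
          Tendsto (fun ε : ℝ => ⨍ y in Ω ∩ ball x ε, trunc k (u y)) (𝓝[>] 0) (𝓝 0)) ∨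
        g x = -1

/-! ### The space `W_0^{1,1}(Ω)` and its dual -/

/-- The linear space of the pairs `(φ, ∇φ)`, `φ ∈ C_c^1(Ω)`, inside `L^1(Ω) × L^1(Ω)^N`. -/
noncomputable def testPairs (Ω : Set (Eucl N)) :
    Submodule ℝ (Lp ℝ 1 (volume.restrict Ω) × Lp (Eucl N) 1 (volume.restrict Ω)) where
  carrier := {p | ∃ φ, IsTest Ω φ ∧ p.1 =ᵐ[volume.restrict Ω] φ ∧
    p.2 =ᵐ[volume.restrict Ω] gradient φ}
  zero_mem' := by
    refine ⟨fun _ => 0, ⟨contDiff_const, HasCompactSupport.zero, ?_⟩, ?_, ?_⟩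
    · simp [tsupport]
    · exact Lp.coeFn_zero _ _ _
    · refine (Lp.coeFn_zero _ _ _).trans (Eventually.of_forall fun x => ?_)
      simp [gradient]
  add_mem' := by
    rintro p q ⟨φ, hφ, h1, h2⟩ ⟨ψ, hψ, k1, k2⟩
    refine ⟨φ + ψ, ⟨hφ.1.add hψ.1, hφ.2.add hψ.2, ?_⟩, ?_, ?_⟩
    · exact (tsupport_add φ ψ).trans (union_subset hφ.3 hψ.3)
    · filter_upwards [Lp.coeFn_add p.1 q.1, h1, k1] with x a b c
      exact a.trans (by simp [b, c])
    · filter_upwards [Lp.coeFn_add p.2 q.2, h2, k2] with x a b c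
      have d1 : DifferentiableAt ℝ φ x := (hφ.1.differentiable one_ne_zero) x
      have d2 : DifferentiableAt ℝ ψ x := (hψ.1.differentiable one_ne_zero) x
      exact a.trans (by simp [b, c, gradient, fderiv_add d1 d2])
  smul_mem' := by
    rintro t p ⟨φ, hφ, h1, h2⟩
    refine ⟨t • φ, ⟨hφ.1.const_smul t, hφ.2.smul_left, ?_⟩, ?_, ?_⟩
    · exact (tsupport_smul_subset_right (fun _ => t) φ).trans hφ.3
    · filter_upwards [Lp.coeFn_smul t p.1, h1] with x a b
      exact a.trans (by simp [b])
    · filter_upwards [Lp.coeFn_smul t p.2, h2] with x a b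
      have d1 : DifferentiableAt ℝ φ x := (hφ.1.differentiable one_ne_zero) x
      exact a.trans (by simp [b, gradient, fderiv_const_smul d1 t])

/-- The Sobolev space `W_0^{1,1}(Ω)`: the closure of `C_c^1(Ω)` in the norm of `W^{1,1}(Ω)`. An
element is a function together with its weak gradient. -/
def W011 (Ω : Set (Eucl N)) : Type := ↥(testPairs Ω).topologicalClosure

namespace W011

variable {Ω : Set (Eucl N)}

noncomputable instance : AddCommGroup (W011 Ω) :=
  inferInstanceAs (AddCommGroup ↥(testPairs Ω).topologicalClosure)

noncomputable instance : Module ℝ (W011 Ω) :=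
  inferInstanceAs (Module ℝ ↥(testPairs Ω).topologicalClosure)

/-- The underlying function of an element of `W_0^{1,1}(Ω)`. -/
noncomputable def toFun (v : W011 Ω) : Lp ℝ 1 (volume.restrict Ω) :=
  ((testPairs Ω).topologicalClosure.subtype v).1

/-- The weak gradient of an element of `W_0^{1,1}(Ω)`. -/
noncomputable def grad : W011 Ω →ₗ[ℝ] Lp (Eucl N) 1 (volume.restrict Ω) :=
  (LinearMap.snd ℝ _ _).comp (testPairs Ω).topologicalClosure.subtype

/-- `W_0^{1,1}(Ω)` carries the norm `‖v‖ = ∫_Ω |∇v| dx`. -/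
noncomputable instance : SeminormedAddCommGroup (W011 Ω) :=
  SeminormedAddCommGroup.induced (W011 Ω) (Lp (Eucl N) 1 (volume.restrict Ω)) grad

noncomputable instance : NormedSpace ℝ (W011 Ω) :=
  NormedSpace.induced ℝ (W011 Ω) (Lp (Eucl N) 1 (volume.restrict Ω)) grad

theorem norm_eq (v : W011 Ω) : ‖v‖ = ∫ x in Ω, ‖grad v x‖ :=
  L1.norm_eq_integral_norm (grad v)

end W011

/-- The space `W^{-1,∞}(Ω)`, the dual of `W_0^{1,1}(Ω)`, with the dual norm. -/
abbrev WMinusOneInfty (Ω : Set (Eucl N)) : Type := StrongDual ℝ (W011 Ω)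

/-- The function `F` defines the element `L` of `W^{-1,∞}(Ω)`: `⟨L, v⟩ = ∫_Ω F v dx` for every
`v ∈ W_0^{1,1}(Ω)`, the integrals being absolutely convergent. -/
def Represents (Ω : Set (Eucl N)) (F : Eucl N → ℝ) (L : WMinusOneInfty Ω) : Prop :=
  ∀ v : W011 Ω, IntegrableOn (fun x => F x * v.toFun x) Ω ∧ L v = ∫ x in Ω, F x * v.toFun x

end OneLaplace

/-!
Write `F = h(u) f ≥ 0`. Since `-div z = F` with `F ∈ L¹(Ω)` and `‖z‖_∞ ≤ 1`, testing the equation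
with `φ ∈ C_c^1(Ω)` gives `∫ F φ = ∫ z · ∇φ ≤ ∫ |∇φ|`
(`integral_density_mul`, `integral_density_mul_le`).

To pass to the closure one needs absolute values, that is `∫ F |φ| ≤ ∫ |∇φ|`
(`lintegral_density_mul_le_of_isTest`). This follows by using the `C^1` functions
`smoothAbs ε φ = √(φ² + ε²) - ε` as tests: their gradients are pointwise bounded by `|∇φ|`, and they
converge boundedly to `|φ|` as `ε → 0`. If test functions `φ_n` converge to `v` in `W^{1,1}`, a
subsequence converges almost everywhere, and Fatou's lemma yields `∫ F |v| ≤ ∫ |∇v|`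
(`lintegral_density_mul_le`). So `F v` is integrable for each `v ∈ W_0^{1,1}(Ω)`, and
`v ↦ ∫ F v` is a functional of norm at most `1`.
-/

namespace OneLaplace

variable {N : ℕ} {Ω : Set (Eucl N)}

/-! ### Testing the equation -/

/-- If the negative of a signed measure has density `R` on the subsets of `Ω`, its integrals over
`Ω` are integrals against that density. -/
theorem setIntegral_vectorMeasure_eq_neg {R : Eucl N → ℝ≥0∞} (hΩ : MeasurableSet Ω)
    (hR : Integrable R (volume.restrict Ω)) {μ : SignedMeasure (Eucl N)}
    (hμ : ∀ B, MeasurableSet B → B ⊆ Ω → -(μ B) = ∫ x in B, (R x).toReal) (φ : Eucl N → ℝ) :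
    ∫ᵛ x in Ω, φ x ∂•μ = -∫ x in Ω, (R x).toReal * φ x := by
  have hRm : AEMeasurable R (volume.restrict Ω) := hR.1.aemeasurable
  have hRfin : ∫⁻ x in Ω, R x ≠ ∞ := by simpa [HasFiniteIntegral] using hR.2.ne
  have hRlt : ∀ᵐ x ∂volume.restrict Ω, R x < ∞ := ae_lt_top' hRm hRfin
  set m : Measure (Eucl N) := (volume.restrict Ω).withDensity R with hm
  have : IsFiniteMeasure m := isFiniteMeasure_withDensity hRfin
  have key : μ.restrict Ω = -m.toSignedMeasure := by
    ext B hB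
    rw [VectorMeasure.restrict_apply _ hΩ hB, _root_.neg_apply,
      Measure.toSignedMeasure_apply_measurable hB, ← neg_inj, neg_neg,
      hμ _ (hB.inter hΩ) inter_subset_right, measureReal_def, hm, withDensity_apply _ hB,
      Measure.restrict_restrict hB]
    refine integral_toReal (hRm.mono_measure (Measure.restrict_mono_set _ inter_subset_right)) ?_
    exact ae_mono (Measure.restrict_mono_set _ inter_subset_right) hRlt
  -- Mathlib evaluates integrals against `Measure.toSignedMeasure` only for the flipped pairing.
  have flip_eq : (ContinuousLinearMap.lsmul ℝ ℝ : ℝ →L[ℝ] ℝ →L[ℝ] ℝ)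
      = (ContinuousLinearMap.lsmul ℝ ℝ : ℝ →L[ℝ] ℝ →L[ℝ] ℝ).flip := by
    ext; simp
  rw [key, VectorMeasure.integral_neg_vectorMeasure, flip_eq,
    VectorMeasure.integral_toSignedMeasure, hm,
    integral_withDensity_eq_integral_toReal_smul₀ hRm hRlt]
  rfl

theorem integral_density_mul {R : Eucl N → ℝ≥0∞} (hΩ : MeasurableSet Ω)
    (hR : Integrable R (volume.restrict Ω)) {z : Eucl N → Eucl N} {μ : SignedMeasure (Eucl N)}
    (hz : IsDivergence Ω z μ)
    (hμ : ∀ B, MeasurableSet B → B ⊆ Ω → -(μ B) = ∫ x in B, (R x).toReal)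
    {φ : Eucl N → ℝ} (hφ : IsTest Ω φ) :
    ∫ x in Ω, (R x).toReal * φ x = ∫ x in Ω, inner ℝ (z x) (gradient φ x) := by
  rw [hz φ hφ, setIntegral_vectorMeasure_eq_neg hΩ hR hμ, neg_neg]

theorem IsTest.integrable_gradient {φ : Eucl N → ℝ} (hφ : IsTest Ω φ) :
    Integrable (gradient φ) (volume.restrict Ω) := by
  have hc : Continuous (gradient φ) :=
    (InnerProductSpace.toDual ℝ (Eucl N)).symm.continuous.comp
      (hφ.contDiff.continuous_fderiv one_ne_zero)
  refine (hc.integrable_of_hasCompactSupport ?_).restrict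
  exact (hφ.hasCompactSupport.fderiv (𝕜 := ℝ)).comp_left (map_zero _)

theorem IsTest.integrable_density_mul {R : Eucl N → ℝ≥0∞}
    (hR : Integrable R (volume.restrict Ω)) {φ : Eucl N → ℝ} (hφ : IsTest Ω φ) :
    Integrable (fun x => (R x).toReal * φ x) (volume.restrict Ω) := by
  obtain ⟨C, hC⟩ := hφ.hasCompactSupport.exists_bound_of_continuous hφ.contDiff.continuous
  exact (integrable_toReal_of_lintegral_ne_top hR.1.aemeasurable
    (by simpa [HasFiniteIntegral] using hR.2.ne)).mul_bdd
    hφ.contDiff.continuous.aestronglyMeasurable (Eventually.of_forall hC)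

theorem integral_density_mul_le {R : Eucl N → ℝ≥0∞} (hΩ : MeasurableSet Ω)
    (hR : Integrable R (volume.restrict Ω)) {z : Eucl N → Eucl N} {μ : SignedMeasure (Eucl N)}
    (hz : IsDivergence Ω z μ) (hz1 : eLpNorm z ∞ (volume.restrict Ω) ≤ 1)
    (hμ : ∀ B, MeasurableSet B → B ⊆ Ω → -(μ B) = ∫ x in B, (R x).toReal)
    {φ : Eucl N → ℝ} (hφ : IsTest Ω φ) :
    ∫ x in Ω, (R x).toReal * φ x ≤ ∫ x in Ω, ‖gradient φ x‖ := by
  rw [integral_density_mul hΩ hR hz hμ hφ]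
  refine (le_abs_self _).trans
    (norm_integral_le_of_norm_le (f := fun x => inner ℝ (z x) (gradient φ x))
      hφ.integrable_gradient.norm ?_)
  rw [eLpNorm_exponent_top] at hz1
  filter_upwards [ae_le_eLpNormEssSup (f := z) (μ := volume.restrict Ω)] with x hx
  have h1 : ‖z x‖ ≤ 1 := by
    have h2 : ‖z x‖ₑ ≤ 1 := hx.trans hz1
    rwa [← enorm_one (G := ℝ), enorm_le_iff_norm_le, norm_one] at h2
  exact (norm_inner_le_norm _ _).trans (mul_le_of_le_one_left (norm_nonneg _) h1)

/-! ### Smooth approximation of the absolute value -/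

/-- The regularised absolute value `√(φ² + ε²) - ε`, which vanishes where `φ` does. -/
noncomputable def smoothAbs (ε : ℝ) (φ : Eucl N → ℝ) (x : Eucl N) : ℝ := √(φ x ^ 2 + ε ^ 2) - ε

theorem abs_smoothAbs_le {ε : ℝ} (hε : 0 < ε) (φ : Eucl N → ℝ) (x : Eucl N) :
    |smoothAbs ε φ x| ≤ |φ x| := by
  have h1 : ε ≤ √(φ x ^ 2 + ε ^ 2) := Real.le_sqrt_of_sq_le (by nlinarith [sq_nonneg (φ x)])
  have h2 : √(φ x ^ 2 + ε ^ 2) ≤ |φ x| + ε := by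
    refine Real.sqrt_le_iff.2 ⟨by positivity, ?_⟩
    rw [← sq_abs (φ x)]
    nlinarith [abs_nonneg (φ x)]
  rw [smoothAbs, abs_of_nonneg (by linarith)]
  linarith

theorem IsTest.smoothAbs {ε : ℝ} (hε : 0 < ε) {φ : Eucl N → ℝ} (hφ : IsTest Ω φ) :
    IsTest Ω (smoothAbs ε φ) := by
  have hs : Function.support (OneLaplace.smoothAbs ε φ) ⊆ Function.support φ := by
    intro x hx h0
    exact hx (by simp [OneLaplace.smoothAbs, h0, Real.sqrt_sq hε.le])
  have ht : tsupport (OneLaplace.smoothAbs ε φ) ⊆ tsupport φ := closure_mono hs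
  refine ⟨?_, hφ.hasCompactSupport.mono hs, ht.trans hφ.tsupport_subset⟩
  exact (((hφ.contDiff.pow 2).add contDiff_const).sqrt fun x => by positivity).sub contDiff_const

theorem norm_gradient_smoothAbs_le {ε : ℝ} (hε : 0 < ε) {φ : Eucl N → ℝ} {x : Eucl N}
    (hφ : DifferentiableAt ℝ φ x) : ‖gradient (smoothAbs ε φ) x‖ ≤ ‖gradient φ x‖ := by
  have hpos : 0 < φ x ^ 2 + ε ^ 2 := by positivity
  have hd : HasFDerivAt (smoothAbs ε φ) ((φ x / √(φ x ^ 2 + ε ^ 2)) • fderiv ℝ φ x) x := by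
    have h1 := (((hφ.hasFDerivAt.pow 2).add_const (ε ^ 2)).sqrt hpos.ne').sub_const ε
    refine h1.congr_fderiv ?_
    rw [smul_smul]
    congr 1
    field_simp
    simp
  have hq : ‖φ x / √(φ x ^ 2 + ε ^ 2)‖ ≤ 1 := by
    rw [norm_div, Real.norm_eq_abs, Real.norm_of_nonneg (Real.sqrt_nonneg _)]
    refine div_le_one_of_le₀ (Real.abs_le_sqrt ?_) (Real.sqrt_nonneg _)
    nlinarith [sq_nonneg ε]
  rw [gradient, gradient, LinearIsometryEquiv.norm_map, LinearIsometryEquiv.norm_map, hd.fderiv,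
    norm_smul]
  exact mul_le_of_le_one_left (norm_nonneg _) hq

theorem tendsto_smoothAbs (φ : Eucl N → ℝ) (x : Eucl N) :
    Tendsto (fun n : ℕ => smoothAbs (1 / ((n : ℝ) + 1)) φ x) atTop (𝓝 |φ x|) := by
  have hc : Continuous fun ε : ℝ => smoothAbs ε φ x := by
    unfold smoothAbs; fun_prop
  have h0 : smoothAbs 0 φ x = |φ x| := by simp [smoothAbs, Real.sqrt_sq_eq_abs]
  rw [← h0]
  exact (hc.tendsto 0).comp tendsto_one_div_add_atTop_nhds_zero_nat

/-! ### The estimate on `W_0^{1,1}(Ω)` -/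

/-- The inequality `∫ F |φ| ≤ ∫ |∇φ|`, assuming the one without the absolute value. -/
theorem lintegral_density_mul_le_of_isTest {R : Eucl N → ℝ≥0∞}
    (hR : Integrable R (volume.restrict Ω))
    (hle : ∀ φ, IsTest Ω φ → ∫ x in Ω, (R x).toReal * φ x ≤ ∫ x in Ω, ‖gradient φ x‖)
    {φ : Eucl N → ℝ} (hφ : IsTest Ω φ) :
    ∫⁻ x in Ω, ‖(R x).toReal * φ x‖ₑ ≤ ∫⁻ x in Ω, ‖gradient φ x‖ₑ := by
  have hε : ∀ n : ℕ, 0 < 1 / ((n : ℝ) + 1) := fun n => by positivity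
  have hlim : Tendsto (fun n : ℕ => ∫ x in Ω, (R x).toReal * smoothAbs (1 / ((n : ℝ) + 1)) φ x)
      atTop (𝓝 (∫ x in Ω, (R x).toReal * |φ x|)) := by
    refine tendsto_integral_of_dominated_convergence (fun x => ‖(R x).toReal * φ x‖)
      (fun n => ((hφ.smoothAbs (hε n)).integrable_density_mul hR).1)
      (hφ.integrable_density_mul hR).norm (fun n => Eventually.of_forall fun x => ?_)
      (Eventually.of_forall fun x => (tendsto_smoothAbs φ x).const_mul _)
    rw [norm_mul, norm_mul]
    exact mul_le_mul_of_nonneg_left (abs_smoothAbs_le (hε n) φ x) (norm_nonneg _)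
  have hfin : ∫ x in Ω, ‖(R x).toReal * φ x‖ ≤ ∫ x in Ω, ‖gradient φ x‖ := by
    have h1 : ∀ x, ‖(R x).toReal * φ x‖ = (R x).toReal * |φ x| := fun x => by simp
    simp_rw [h1]
    refine le_of_tendsto' hlim fun n => (hle _ (hφ.smoothAbs (hε n))).trans ?_
    exact integral_mono (hφ.smoothAbs (hε n)).integrable_gradient.norm
      hφ.integrable_gradient.norm fun x =>
        norm_gradient_smoothAbs_le (hε n) (hφ.contDiff.differentiable one_ne_zero x)
  rw [← ofReal_integral_norm_eq_lintegral_enorm (hφ.integrable_density_mul hR),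
    ← ofReal_integral_norm_eq_lintegral_enorm hφ.integrable_gradient]
  exact ENNReal.ofReal_le_ofReal hfin

/-- The inequality `∫ F |v| ≤ ∫ |∇v|` passes from test functions to the closure, by Fatou's lemma
along an almost everywhere convergent subsequence. -/
theorem lintegral_density_mul_le {R : Eucl N → ℝ≥0∞} (hR : Integrable R (volume.restrict Ω))
    (hle : ∀ φ, IsTest Ω φ →
      ∫⁻ x in Ω, ‖(R x).toReal * φ x‖ₑ ≤ ∫⁻ x in Ω, ‖gradient φ x‖ₑ)
    {p : Lp ℝ 1 (volume.restrict Ω) × Lp (Eucl N) 1 (volume.restrict Ω)}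
    (hp : p ∈ (testPairs Ω).topologicalClosure) :
    ∫⁻ x in Ω, ‖(R x).toReal * p.1 x‖ₑ ≤ ‖p.2‖ₑ := by
  obtain ⟨q, hq, hqp⟩ := mem_closure_iff_seq_limit.1 hp
  have hbound : ∀ n, ∫⁻ x in Ω, ‖(R x).toReal * (q n).1 x‖ₑ ≤ ‖(q n).2‖ₑ := by
    intro n
    obtain ⟨φ, hφ, h1, h2⟩ := hq n
    rw [Lp.enorm_def, eLpNorm_one_eq_lintegral_enorm]
    calc ∫⁻ x in Ω, ‖(R x).toReal * (q n).1 x‖ₑ = ∫⁻ x in Ω, ‖(R x).toReal * φ x‖ₑ :=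
          lintegral_congr_ae (h1.mono fun x hx => by simp only [hx])
      _ ≤ ∫⁻ x in Ω, ‖gradient φ x‖ₑ := hle φ hφ
      _ = ∫⁻ x in Ω, ‖(q n).2 x‖ₑ := lintegral_congr_ae (h2.mono fun x hx => by simp only [hx])
  obtain ⟨ns, hns, hae⟩ :=
    (tendstoInMeasure_of_tendsto_Lp ((continuous_fst.tendsto p).comp hqp)).exists_seq_tendsto_ae
  have hlim : Tendsto (fun i => ‖(q (ns i)).2‖ₑ) atTop (𝓝 ‖p.2‖ₑ) :=
    (((continuous_enorm.comp continuous_snd).tendsto p).comp hqp).comp hns.tendsto_atTop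
  have hRm : AEMeasurable (fun x => (R x).toReal) (volume.restrict Ω) :=
    hR.1.aemeasurable.ennreal_toReal
  calc ∫⁻ x in Ω, ‖(R x).toReal * p.1 x‖ₑ
      = ∫⁻ x in Ω, liminf (fun i => ‖(R x).toReal * (q (ns i)).1 x‖ₑ) atTop := by
        refine lintegral_congr_ae (hae.mono fun x hx => ?_)
        exact ((continuous_enorm.tendsto _).comp (hx.const_mul (R x).toReal)).liminf_eq.symm
    _ ≤ liminf (fun i => ∫⁻ x in Ω, ‖(R x).toReal * (q (ns i)).1 x‖ₑ) atTop :=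
        lintegral_liminf_le' fun i => (hRm.mul (Lp.aestronglyMeasurable _).aemeasurable).enorm
    _ ≤ liminf (fun i => ‖(q (ns i)).2‖ₑ) atTop :=
        liminf_le_liminf (Eventually.of_forall fun i => hbound (ns i))
    _ = ‖p.2‖ₑ := hlim.liminf_eq

/-- A density with `∫ F |v| ≤ ‖v‖` on `W_0^{1,1}(Ω)` represents an element of the unit ball of
`W^{-1,∞}(Ω)`. -/
theorem exists_represents {F : Eucl N → ℝ} (hF : AEMeasurable F (volume.restrict Ω))
    (hle : ∀ v : W011 Ω, ∫⁻ x in Ω, ‖F x * v.toFun x‖ₑ ≤ ‖W011.grad v‖ₑ) :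
    ∃ L : WMinusOneInfty Ω, Represents Ω F L ∧ ‖L‖ ≤ 1 := by
  have hint : ∀ v : W011 Ω, IntegrableOn (fun x => F x * v.toFun x) Ω := fun v =>
    ⟨(hF.mul (Lp.aestronglyMeasurable v.toFun).aemeasurable).aestronglyMeasurable,
      (hle v).trans_lt enorm_lt_top⟩
  let A : W011 Ω →ₗ[ℝ] ℝ :=
    { toFun := fun v => ∫ x in Ω, F x * v.toFun x
      map_add' := fun v w => by
        rw [← integral_add (hint v) (hint w)]
        refine integral_congr_ae ((Lp.coeFn_add v.toFun w.toFun).mono fun x hx => ?_)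
        exact (congrArg (F x * ·) hx).trans (mul_add _ _ _)
      map_smul' := fun t v => by
        rw [RingHom.id_apply, smul_eq_mul, ← integral_const_mul]
        refine integral_congr_ae ((Lp.coeFn_smul t v.toFun).mono fun x hx => ?_)
        exact (congrArg (F x * ·) hx).trans (mul_left_comm _ _ _) }
  have hA : ∀ v, ‖A v‖ ≤ 1 * ‖v‖ := fun v => by
    rw [one_mul]
    have h1 : ‖A v‖ₑ ≤ ‖W011.grad v‖ₑ := (enorm_integral_le_lintegral_enorm _).trans (hle v)
    exact enorm_le_iff_norm_le.1 h1
  exact ⟨A.mkContinuous 1 hA, fun v => ⟨hint v, rfl⟩, A.mkContinuous_norm_le zero_le_one hA⟩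

end OneLaplace

theorem proposition3p4 (N : ℕ) (hN : 1 ≤ N)
    (Ω : Set (OneLaplace.Eucl N)) (hΩ_open : IsOpen Ω) (hΩ_bdd : Bornology.IsBounded Ω)
    (hΩ_lip : OneLaplace.HasLipschitzBoundary Ω)
    (f : OneLaplace.Eucl N → ℝ) (hf_int : IntegrableOn f Ω)
    (hf_nonneg : ∀ᵐ x ∂(volume.restrict Ω), 0 ≤ f x)
    (h : ℝ≥0 → ℝ≥0∞) (h_cont : Continuous h) (h_pos : ∀ s, 0 < h s)
    (h_fin : ∀ s, s ≠ 0 → h s ≠ ∞)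
    (h1 : ∃ (c s₁ : ℝ≥0) (γ : ℝ), 0 < c ∧ 0 < s₁ ∧ 0 ≤ γ ∧
      ∀ s ≤ s₁, h s ≤ (c : ℝ≥0∞) / (s : ℝ≥0∞) ^ γ)
    (hinf : ℝ≥0) (h2 : Tendsto h atTop (𝓝 (hinf : ℝ≥0∞)))
    (u : OneLaplace.Eucl N → ℝ≥0∞) (hu : OneLaplace.IsSolution Ω h hinf f u) :
    ∃ L : OneLaplace.WMinusOneInfty Ω,
      OneLaplace.Represents Ω (fun x => (OneLaplace.reaction h hinf f u x).toReal) L ∧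
      ‖L‖ ≤ 1 := by
  obtain ⟨-, z, μ, ⟨-, hdiv⟩, hz1, hR, hμ, -⟩ := hu
  refine OneLaplace.exists_represents hR.1.aemeasurable.ennreal_toReal fun v => ?_
  exact OneLaplace.lintegral_density_mul_le hR
    (fun φ hφ => OneLaplace.lintegral_density_mul_le_of_isTest hR
      (fun ψ hψ => OneLaplace.integral_density_mul_le hΩ_open.measurableSet hR hdiv hz1 hμ hψ) hφ)
    v.2
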